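/- Let $2^\omega$ be the Cantor space with its product topology. Let $$\mathrm{non}(\mathcal M)=\min\{|X| : X\subseteq 2^\omega \text{ is not meager}\}$$ and let $$\mathfrak{sn}^*=\min\{|X| : X\subseteq 2^\omega \text{ and there is a } \mathbf{\Sigma}^1_1 \text{ (analytic) set } A\subseteq 2^\omega \text{ such that } A\cap X\neq B\cap X \text{ for every Borel set } B\subseteq 2^\omega\}.$$ Then both minima exist (that is, they are taken over nonempty classes), and $\mathfrak{sn}^*\leq \mathrm{non}(\mathcal M)$. -/

import Mathlib

open Cardinal

/-- Cantor space `2^ω`, with the product topology of the discrete two-point space. -/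
abbrev Cantor : Type := ℕ → Bool

/-- The cardinalities of the nonmeager subsets of `2^ω`. -/
def nonmeagerCards : Set Cardinal.{0} :=
  {κ | ∃ X : Set Cantor, ¬ IsMeagre X ∧ #X = κ}

/-- `non(M)`: the least cardinality of a nonmeager subset of `2^ω`. -/
noncomputable def nonM : Cardinal.{0} := sInf nonmeagerCards

/-- The cardinalities of the sets `X ⊆ 2^ω` for which there is a boldface `Σ¹₁` (analytic)
set `A ⊆ 2^ω` such that `A ∩ X ≠ B ∩ X` for every Borel set `B ⊆ 2^ω`. -/
def snStarCards : Set Cardinal.{0} :=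
  {κ | ∃ X : Set Cantor,
    (∃ A : Set Cantor, MeasureTheory.AnalyticSet A ∧
      ∀ B : Set Cantor, @MeasurableSet Cantor (borel Cantor) B → A ∩ X ≠ B ∩ X) ∧ #X = κ}

/-- The variant Souslin number `sn*`. -/
noncomputable def snStar : Cardinal.{0} := sInf snStarCards

/-! The argument follows Steel forcing, with "comeager in a cylinder" as the forcing relation. A
point of `ℕ → ℕ × ℕ` codes a graph whose vertices carry ordinal tags at most `θ < ω₁`; tags drop
along edges, except that `θ` may follow `θ` and so acts as infinity. A root tagged below `θ` starts
no infinite path; a root tagged `θ` generically starts one. A Borel set of edge relations, however,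
cannot tell apart tags above some `τ < ω₁` that does not depend on `θ` (`exists_insensitive`), so
with `θ = τ + 1` it cannot separate the root tags `τ` and `θ`. For nonmeager `X`, the sequences
`firstTrue x` with `x ∈ X` meet every comeager set. Varying `θ` and a finite prefix gives at most
`ℵ₁ · ℵ₀ · #X = #X` codes, on which having an infinite path from `0` is not relatively Borel. -/

open Set Filter Topology PiNat

/-! ### Category forcing on cylinders -/

section Splice

variable {E : Type*}

/-- The sequence that agrees with `w` below `N` and with `z` from `N` on. -/
def splice (N : ℕ) (w z : ℕ → E) : ℕ → E := fun n => if n < N then w n else z n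

lemma splice_of_lt {N n : ℕ} (h : n < N) (w z : ℕ → E) : splice N w z n = w n := if_pos h

lemma splice_of_le {N n : ℕ} (h : N ≤ n) (w z : ℕ → E) : splice N w z n = z n :=
  if_neg h.not_gt

lemma splice_splice {N M : ℕ} (hNM : N ≤ M) {w w' : ℕ → E} (h : ∀ n < N, w' n = w n)
    (z : ℕ → E) : splice N w (splice M w' z) = splice M w' z := by
  funext n
  rcases lt_or_ge n N with hn | hn
  · rw [splice_of_lt hn, splice_of_lt (hn.trans_le hNM), h n hn]
  · rw [splice_of_le hn]

lemma splice_splice_left {N M : ℕ} (hNM : N ≤ M) (w w' z : ℕ → E) :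
    splice N w (splice M w' z) = splice M (splice N w w') z := by
  funext n
  simp only [splice]
  split_ifs <;> first | rfl | omega

lemma splice_congr {N : ℕ} {w w' : ℕ → E} (h : ∀ n < N, w' n = w n) (z : ℕ → E) :
    splice N w' z = splice N w z := by
  funext n
  simp only [splice]
  split_ifs with hn
  · exact h n hn
  · rfl

variable [TopologicalSpace E]

lemma continuous_splice (N : ℕ) (w : ℕ → E) : Continuous (splice N w) := by
  refine continuous_pi fun n => ?_
  simp only [splice]
  split_ifs
  · exact continuous_const
  · exact continuous_apply n

/-- The set `S` is comeager in the cylinder of sequences agreeing with `w` below `N`. -/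
def Forces (N : ℕ) (w : ℕ → E) (S : Set (ℕ → E)) : Prop :=
  ∀ᶠ z in residual (ℕ → E), splice N w z ∈ S

lemma Forces.and {N : ℕ} {w : ℕ → E} {S T : Set (ℕ → E)} (hS : Forces N w S)
    (hT : Forces N w T) : Forces N w (S ∩ T) := Eventually.and hS hT

lemma Forces.exists [BaireSpace (ℕ → E)] [Nonempty E] {N : ℕ} {w : ℕ → E} {S : Set (ℕ → E)}
    (hS : Forces N w S) : ∃ z, splice N w z ∈ S :=
  (dense_of_mem_residual hS).nonempty

variable [DiscreteTopology E]

lemma exists_cylinder_subset {U : Set (ℕ → E)} (hU : IsOpen U) {z : ℕ → E} (hz : z ∈ U) (N : ℕ) :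
    ∃ M ≥ N, cylinder z M ⊆ U := by
  obtain ⟨-, ⟨x, n, rfl⟩, hzx, hsub⟩ :=
    (isTopologicalBasis_cylinders (fun _ : ℕ => E)).exists_subset_of_mem_open hz hU
  rw [← mem_cylinder_iff_eq.1 hzx] at hsub
  exact ⟨max N n, le_max_left _ _, (cylinder_anti z (le_max_right _ _)).trans hsub⟩

lemma isOpenMap_splice (N : ℕ) (w : ℕ → E) : IsOpenMap (splice N w) := by
  intro U hU
  rw [isOpen_iff_mem_nhds]
  rintro - ⟨z, hz, rfl⟩
  obtain ⟨M, hM, hsub⟩ := exists_cylinder_subset hU hz N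
  refine mem_of_superset ((isOpen_cylinder _ (splice N w z) M).mem_nhds
    (self_mem_cylinder _ _)) fun y hy => ⟨splice N z y, hsub fun i hi => ?_, ?_⟩
  · rcases lt_or_ge i N with h | h
    · exact splice_of_lt h _ _
    · rw [splice_of_le h, hy i hi, splice_of_le h]
  · funext i
    rcases lt_or_ge i N with h | h
    · rw [splice_of_lt h, hy i (h.trans_le hM), splice_of_lt h]
    · rw [splice_of_le h, splice_of_le h]

lemma tendsto_splice_residual (N : ℕ) (w : ℕ → E) :
    Tendsto (splice N w) (residual (ℕ → E)) (residual (ℕ → E)) :=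
  tendsto_residual_of_isOpenMap (continuous_splice N w) (isOpenMap_splice N w)

lemma Forces.extend {N M : ℕ} {w w' : ℕ → E} {S : Set (ℕ → E)} (hS : Forces N w S)
    (hNM : N ≤ M) (h : ∀ n < N, w' n = w n) : Forces M w' S := by
  filter_upwards [(tendsto_splice_residual M w').eventually hS] with z hz
  rwa [splice_splice hNM h] at hz

/-- By the Baire property, the complement of `S` in the cylinder is open modulo meager. If that open
set is empty, `S` is forced; otherwise any cylinder inside it works. -/
lemma exists_forces_compl [BaireSpace (ℕ → E)] {N : ℕ} {w : ℕ → E} {S : Set (ℕ → E)}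
    (hS : BaireMeasurableSet S) (h : ¬ Forces N w S) :
    ∃ M ≥ N, ∃ w', (∀ n < N, w' n = w n) ∧ Forces M w' Sᶜ := by
  have hT : BaireMeasurableSet (splice N w ⁻¹' Sᶜ) :=
    hS.compl.preimage (continuous_splice N w) (isOpenMap_splice N w)
  obtain ⟨U, hU, hTU⟩ := hT.residualEq_isOpen
  rcases U.eq_empty_or_nonempty with rfl | ⟨z₀, hz₀⟩
  · refine absurd ?_ h
    filter_upwards [hTU] with z hz
    by_contra hzS
    exact (hz.mp hzS : z ∈ (∅ : Set (ℕ → E)))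
  · obtain ⟨M, hM, hsub⟩ := exists_cylinder_subset hU hz₀ N
    refine ⟨M, hM, splice N w z₀, fun n hn => splice_of_lt hn _ _, ?_⟩
    filter_upwards [(tendsto_splice_residual M z₀).eventually hTU] with z hz
    have := hz.mpr (hsub fun i hi => splice_of_lt hi z₀ z)
    rwa [← splice_splice_left hM]

end Splice

/-! ### Tagged graphs and retagging -/

section TaggedGraphs

/-- Vertex `m` of the graph coded by `w` has tag `t (w m).1` and candidate parent `(w m).2`. The
candidate is accepted if it is a smaller number and its tag is larger, or both tags are `θ`. -/
def Edge (t : ℕ → Ordinal.{0}) (θ : Ordinal.{0}) (w : ℕ → ℕ × ℕ) (n m : ℕ) : Prop :=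
  n < m ∧ (w m).2 = n ∧ (t (w m).1 < t (w n).1 ∨ t (w m).1 = θ ∧ t (w n).1 = θ)

/-- Two tagged graphs have the same edges below `N`, and there each vertex has the same tag in both
graphs or has tag at least `τ` in both. -/
def TagSimilar (t : ℕ → Ordinal.{0}) (θ τ : Ordinal.{0}) (N : ℕ) (w w' : ℕ → ℕ × ℕ) : Prop :=
  (∀ n m, m < N → (Edge t θ w n m ↔ Edge t θ w' n m)) ∧
    ∀ n < N, t (w n).1 = t (w' n).1 ∨ τ ≤ t (w n).1 ∧ τ ≤ t (w' n).1

variable {t : ℕ → Ordinal.{0}} {θ : Ordinal.{0}}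

lemma edge_congr {w w' : ℕ → ℕ × ℕ} {n m : ℕ} (h : ∀ i ≤ m, w i = w' i) :
    Edge t θ w n m ↔ Edge t θ w' n m := by
  unfold Edge
  refine and_congr_right fun hnm => ?_
  rw [h m le_rfl, h n hnm.le]

lemma TagSimilar.symm {τ : Ordinal.{0}} {N : ℕ} {w w' : ℕ → ℕ × ℕ} (h : TagSimilar t θ τ N w w') :
    TagSimilar t θ τ N w' w :=
  ⟨fun n m hm => (h.1 n m hm).symm, fun n hn => (h.2 n hn).imp Eq.symm And.symm⟩

/-- The retagging lemma: similarity extends to extensions, at the cost of lowering the threshold. -/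
lemma TagSimilar.exists_extend (ht : range t = Iic θ) {τ τ' : Ordinal.{0}}
    (hτ : τ' + Ordinal.omega0 ≤ τ) {N K : ℕ} {p p' q : ℕ → ℕ × ℕ} (h : TagSimilar t θ τ N p p')
    (hq : ∀ n < N, q n = p' n) :
    ∃ r, (∀ n < N, r n = p n) ∧ TagSimilar t θ τ' K r q := by
  classical
  have hle : ∀ k, t k ≤ θ := fun k => (ht ▸ mem_range_self k : t k ∈ Iic θ)
  have hlt : ∀ k : ℕ, τ' + k < τ := fun k =>
    (add_lt_add_right (Ordinal.natCast_lt_omega0 k) τ').trans_le hτ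
  have hτ' : τ' ≤ τ := le_self_add.trans hτ
  have hc : ∀ m, ∃ c, t c = min (t (q m).1) (τ' + (K - m : ℕ)) := fun m => by
    have : min (t (q m).1) (τ' + (K - m : ℕ)) ∈ range t := by
      rw [ht]; exact (min_le_left _ _).trans (hle _)
    exact this
  choose c hc using hc
  -- New tags are capped at `τ' + (K - m)`. The caps decrease strictly in `m`, so tags still drop
  -- along edges, and they stay below `τ`, hence below every old tag that may differ. A vertex
  -- naming itself as parent has no incoming edge.
  let r : ℕ → ℕ × ℕ := fun m =>
    if m < N then p m else (c m, if Edge t θ q (q m).2 m then (q m).2 else m)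
  have hr : ∀ n < N, r n = p n := fun n hn => if_pos hn
  have hr' : ∀ n, N ≤ n → r n = (c n, if Edge t θ q (q n).2 n then (q n).2 else n) :=
    fun n hn => if_neg hn.not_gt
  refine ⟨r, hr, fun n m hm => ?_, fun n hn => ?_⟩
  · rcases lt_or_ge m N with hmN | hmN
    · rw [edge_congr fun i hi => hr i (hi.trans_lt hmN), h.1 n m hmN,
        edge_congr fun i hi => hq i (hi.trans_lt hmN)]
    · constructor
      · rintro ⟨hnm, hpar, -⟩
        rw [hr' m hmN] at hpar
        dsimp only at hpar
        split_ifs at hpar with he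
        · rwa [hpar] at he
        · omega
      · rintro ⟨hnm, hpar, hV⟩
        have he : Edge t θ q (q m).2 m := by rw [hpar]; exact ⟨hnm, hpar, hV⟩
        refine ⟨hnm, by rw [hr' m hmN]; exact (if_pos he).trans hpar, ?_⟩
        have hm' : t (r m).1 = min (t (q m).1) (τ' + (K - m : ℕ)) := by rw [hr' m hmN, hc]
        rw [hm']
        rcases lt_or_ge n N with hnN | hnN
        · rw [hr n hnN]
          rcases h.2 n hnN with h1 | ⟨h1, -⟩
          · rw [h1, ← hq n hnN]
            rcases hV with hV | ⟨hV1, hV2⟩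
            · exact Or.inl ((min_le_left _ _).trans_lt hV)
            · rw [hV1, hV2]
              exact (min_le_left _ _).lt_or_eq.imp id fun h => ⟨h, rfl⟩
          · exact Or.inl ((min_le_right _ _).trans_lt ((hlt _).trans_le h1))
        · have hn' : t (r n).1 = min (t (q n).1) (τ' + (K - n : ℕ)) := by rw [hr' n hnN, hc]
          rw [hn']
          have hlt' : τ' + (K - m : ℕ) < τ' + (K - n : ℕ) :=
            add_lt_add_right (by exact_mod_cast (by omega : K - m < K - n)) _
          rcases hV with hV | ⟨hV1, hV2⟩
          · exact Or.inl (min_lt_min hV hlt')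
          · rw [hV1, hV2]
            rcases le_or_gt θ (τ' + (K - m : ℕ)) with h | h
            · exact Or.inr ⟨min_eq_left h, min_eq_left (h.trans hlt'.le)⟩
            · exact Or.inl (by rw [min_eq_right h.le]; exact lt_min h hlt')
  · rcases lt_or_ge n N with hnN | hnN
    · rw [hr n hnN, hq n hnN]
      exact (h.2 n hnN).imp id fun h => ⟨hτ'.trans h.1, hτ'.trans h.2⟩
    · have hn' : t (r n).1 = min (t (q n).1) (τ' + (K - n : ℕ)) := by rw [hr' n hnN, hc]
      rw [hn']
      rcases le_or_gt (t (q n).1) (τ' + (K - n : ℕ)) with h | h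
      · exact Or.inl (min_eq_left h)
      · rw [min_eq_right h.le]
        exact Or.inr ⟨le_self_add, le_self_add.trans h.le⟩

open Classical in
/-- The edge relation of the tagged graph coded by `w`, as a point of Cantor space. -/
noncomputable def edgeCode (t : ℕ → Ordinal.{0}) (θ : Ordinal.{0}) (w : ℕ → ℕ × ℕ) : Cantor :=
  fun k => decide (Edge t θ w k.unpair.1 k.unpair.2)

lemma edgeCode_apply {w : ℕ → ℕ × ℕ} {k : ℕ} :
    edgeCode t θ w k = true ↔ Edge t θ w k.unpair.1 k.unpair.2 := by
  simp [edgeCode]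

lemma edgeCode_congr {w w' : ℕ → ℕ × ℕ} {k : ℕ}
    (h : Edge t θ w k.unpair.1 k.unpair.2 ↔ Edge t θ w' k.unpair.1 k.unpair.2) :
    edgeCode t θ w k = edgeCode t θ w' k := by
  rw [Bool.eq_iff_iff, edgeCode_apply, edgeCode_apply, h]

lemma continuous_edgeCode : Continuous (edgeCode t θ) := by
  refine continuous_pi fun k => ?_
  let f : (ℕ × ℕ) × (ℕ × ℕ) → Bool := open Classical in fun a =>
    decide (k.unpair.1 < k.unpair.2 ∧ a.2.2 = k.unpair.1 ∧
      (t a.2.1 < t a.1.1 ∨ t a.2.1 = θ ∧ t a.1.1 = θ))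
  have hpair : Continuous fun w : ℕ → ℕ × ℕ => (w k.unpair.1, w k.unpair.2) := by fun_prop
  refine ((continuous_of_discreteTopology (f := f)).comp hpair).congr fun w => ?_
  exact decide_eq_decide.2 Iff.rfl

lemma baireMeasurableSet_preimage_edgeCode {B : Set Cantor} (hB : MeasurableSet B) :
    BaireMeasurableSet (edgeCode t θ ⁻¹' B) :=
  (continuous_edgeCode.measurable hB).baireMeasurableSet

/-- Similarity with threshold `τ` preserves forcing of the event that the edge code is in `B`. -/
def Insensitive (τ : Ordinal.{0}) (B : Set Cantor) : Prop :=
  ∀ (t : ℕ → Ordinal.{0}) (θ : Ordinal.{0}), range t = Iic θ → ∀ (N : ℕ) (w w' : ℕ → ℕ × ℕ),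
    TagSimilar t θ τ N w w' → Forces N w (edgeCode t θ ⁻¹' B) → Forces N w' (edgeCode t θ ⁻¹' B)

/-- A prefix longer than `k.unpair.2` decides bit `k`, and similar prefixes have the same edges. -/
lemma insensitive_coordinate (k : ℕ) (s : Set Bool) :
    Insensitive Ordinal.omega0 ((fun x : Cantor => x k) ⁻¹' s) := by
  intro t θ ht N w w' hw hf
  by_contra hf'
  obtain ⟨M, hM, q, hq, hqf⟩ := exists_forces_compl (baireMeasurableSet_preimage_edgeCode
    (measurable_pi_apply k (MeasurableSet.of_discrete (s := s)))) hf'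
  let K := max M (k.unpair.2 + 1)
  have hqK := hqf.extend (le_max_left M (k.unpair.2 + 1)) (w' := q) fun _ _ => rfl
  obtain ⟨r, hr, hrq⟩ := hw.exists_extend ht (τ' := 0) (by simp) hq (K := K)
  obtain ⟨z, hz⟩ := (hf.extend (hM.trans (le_max_left _ _)) hr : Forces K r _).exists
  obtain ⟨y, hy⟩ := hqK.exists
  refine hy ?_
  have hk : k.unpair.2 < K := lt_of_lt_of_le (Nat.lt_succ_self _) (le_max_right _ _)
  have : edgeCode t θ (splice K q y) k = edgeCode t θ (splice K r z) k := by
    refine edgeCode_congr ?_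
    rw [edge_congr fun i hi => splice_of_lt (hi.trans_lt hk) q y,
      edge_congr fun i hi => splice_of_lt (hi.trans_lt hk) r z, hrq.1 _ _ hk]
  change edgeCode t θ (splice K q y) k ∈ s
  rw [this]
  exact hz

/-- Otherwise some extension of `w'` forces some `B i`. Retagging yields a similar extension of `w`,
which then forces both `B i` and its complement. -/
lemma Insensitive.iInter_compl {B : ℕ → Set Cantor} {σ : ℕ → Ordinal.{0}} {τ : Ordinal.{0}}
    (hB : ∀ i, MeasurableSet (B i)) (h : ∀ i, Insensitive (σ i) (B i))
    (hτ : ∀ i, σ i + Ordinal.omega0 ≤ τ) : Insensitive τ (⋂ i, (B i)ᶜ) := by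
  intro t θ ht N w w' hw hf
  rw [preimage_iInter]
  refine (eventually_countable_forall.2 fun i => ?_ :
    ∀ᶠ z in residual _, ∀ i, splice N w' z ∈ edgeCode t θ ⁻¹' (B i)ᶜ).mono fun z hz =>
      mem_iInter.2 hz
  by_contra hf'
  obtain ⟨M, hM, q, hq, hqf⟩ := exists_forces_compl
    (baireMeasurableSet_preimage_edgeCode (hB i).compl) hf'
  obtain ⟨r, hr, hrq⟩ := hw.exists_extend ht (hτ i) hq (K := M)
  rw [← preimage_compl, compl_compl] at hqf
  have h1 := h i t θ ht M q r hrq.symm hqf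
  obtain ⟨z, hz1, hz2⟩ := (h1.and (hf.extend hM hr)).exists
  exact mem_iInter.1 hz2 i hz1

lemma Insensitive.compl {B : Set Cantor} {τ : Ordinal.{0}} (hB : MeasurableSet B)
    (h : Insensitive τ B) : Insensitive (τ + Ordinal.omega0) Bᶜ := by
  have := Insensitive.iInter_compl (B := fun _ => B) (fun _ => hB) (fun _ => h) fun _ => le_rfl
  rwa [iInter_const] at this

/-- The sets with a countable threshold form a σ-algebra containing the coordinate events: each
operation costs a countable supremum and multiples of `ω`. -/
lemma exists_insensitive {B : Set Cantor} (hB : MeasurableSet B) :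
    ∃ τ < Ordinal.omega 1, Insensitive τ B := by
  have hadd : ∀ {τ : Ordinal.{0}}, τ < Ordinal.omega 1 → τ + Ordinal.omega0 < Ordinal.omega 1 :=
    fun hτ => Ordinal.isPrincipal_add_omega 1 hτ Ordinal.omega0_lt_omega_one
  let 𝓢 : MeasurableSpace Cantor :=
    { MeasurableSet' := fun B => MeasurableSet B ∧ ∃ τ < Ordinal.omega 1, Insensitive τ B
      measurableSet_empty := ⟨.empty, 0, Ordinal.omega_pos 1, fun t θ ht N w w' _ hf => by
        obtain ⟨z, hz⟩ := hf.exists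
        exact hz.elim⟩
      measurableSet_compl := fun B ⟨hB, τ, hτ, h⟩ => ⟨hB.compl, _, hadd hτ, h.compl hB⟩
      measurableSet_iUnion := fun B hB => by
        choose hm τ hτ h using hB
        have hsup : ⨆ i, (τ i + Ordinal.omega0) < Ordinal.omega 1 :=
          Ordinal.iSup_lt_omega_one fun i => hadd (hτ i)
        refine ⟨.iUnion hm, _, hadd hsup, ?_⟩
        have := (Insensitive.iInter_compl hm h fun i =>
          Ordinal.le_iSup (fun i => τ i + Ordinal.omega0) i).compl (.iInter fun i => (hm i).compl)
        rwa [compl_iInter, iUnion_congr fun i => compl_compl (B i)] at this }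
  have hle : (MeasurableSpace.pi : MeasurableSpace Cantor) ≤ 𝓢 := by
    refine iSup_le fun k => ?_
    rintro - ⟨s, -, rfl⟩
    exact ⟨measurable_pi_apply k MeasurableSet.of_discrete, _, Ordinal.omega0_lt_omega_one,
      insensitive_coordinate k s⟩
  exact (hle B hB).2

end TaggedGraphs

/-! ### Infinite paths from the root -/

section IllFounded

/-- The codes of relations on `ℕ` with an infinite path that starts at `0`. -/
def illFoundedCodes : Set Cantor :=
  {x | ∃ f : ℕ → ℕ, f 0 = 0 ∧ ∀ i, x (Nat.pair (f i) (f (i + 1))) = true}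

lemma analyticSet_illFoundedCodes : MeasureTheory.AnalyticSet illFoundedCodes := by
  have heval : Continuous fun a : Cantor × ℕ => a.1 a.2 :=
    continuous_prod_of_discrete_right.2 fun n => continuous_apply n
  have hclosed : IsClosed {a : Cantor × (ℕ → ℕ) |
      a.2 0 = 0 ∧ ∀ i, a.1 (Nat.pair (a.2 i) (a.2 (i + 1))) = true} := by
    simp only [ofPred_and, ofPred_forall]
    refine (isClosed_eq (by fun_prop) continuous_const).inter
      (isClosed_iInter fun i => isClosed_eq ?_ continuous_const)
    have hpair : Continuous fun b : ℕ × ℕ => Nat.pair b.1 b.2 := continuous_of_discreteTopology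
    have hg : Continuous fun a : Cantor × (ℕ → ℕ) => Nat.pair (a.2 i) (a.2 (i + 1)) :=
      hpair.comp (f := fun a : Cantor × (ℕ → ℕ) => (a.2 i, a.2 (i + 1))) (by fun_prop)
    exact heval.comp (continuous_fst.prodMk hg)
  have : TopologicalSpace.SeparableSpace (Cantor × (ℕ → ℕ)) :=
    TopologicalSpace.SecondCountableTopology.to_separableSpace
  have : PolishSpace (Cantor × (ℕ → ℕ)) := inferInstance
  have hproj := hclosed.analyticSet.image_of_continuous continuous_fst
  convert hproj
  ext x
  simp [illFoundedCodes]

variable {t : ℕ → Ordinal.{0}} {θ : Ordinal.{0}}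

lemma edgeCode_pair {w : ℕ → ℕ × ℕ} {n m : ℕ} :
    edgeCode t θ w (Nat.pair n m) = true ↔ Edge t θ w n m := by
  rw [edgeCode_apply, Nat.unpair_pair]

lemma edgeCode_notMem_illFoundedCodes {w : ℕ → ℕ × ℕ} (h : t (w 0).1 < θ) :
    edgeCode t θ w ∉ illFoundedCodes := by
  rintro ⟨f, hf0, hf⟩
  have hedge : ∀ i, Edge t θ w (f i) (f (i + 1)) := fun i => edgeCode_pair.1 (hf i)
  have hstep : ∀ i, t (w (f i)).1 < θ → t (w (f (i + 1))).1 < t (w (f i)).1 := fun i hi =>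
    (hedge i).2.2.resolve_right fun h => hi.ne h.2
  have hlt : ∀ i, t (w (f i)).1 < θ := fun i => by
    induction i with
    | zero => rwa [hf0]
    | succ i ih => exact (hstep i ih).trans ih
  exact not_strictAnti_of_wellFoundedLT (fun i => t (w (f i)).1)
    (strictAnti_nat_of_succ_lt fun i => hstep i (hlt i))

lemma eventually_exists_eq (c n : ℕ) :
    ∀ᶠ w in residual (ℕ → ℕ × ℕ), ∃ m > n, w m = (c, n) := by
  refine residual_of_dense_open ?_ ?_
  · have : {w : ℕ → ℕ × ℕ | ∃ m > n, w m = (c, n)} = ⋃ m > n, (fun w => w m) ⁻¹' {(c, n)} := by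
      ext w; simp
    rw [this]
    exact isOpen_biUnion fun m _ => (isOpen_discrete _).preimage (continuous_apply m)
  · refine dense_iff_inter_open.2 fun O hO ⟨w, hw⟩ => ?_
    obtain ⟨M, hM, hsub⟩ := exists_cylinder_subset hO hw (n + 1)
    exact ⟨splice M w fun _ => (c, n), hsub fun i hi => splice_of_lt hi _ _, M, hM,
      splice_of_le le_rfl _ _⟩

/-- Generically every vertex `n` is the candidate parent of a later vertex tagged `θ`; iterating
from `0` builds the path. -/
lemma forces_illFoundedCodes {c : ℕ} (hc : t c = θ) {N : ℕ} {w : ℕ → ℕ × ℕ} (hN : 0 < N)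
    (hw : t (w 0).1 = θ) : Forces N w (edgeCode t θ ⁻¹' illFoundedCodes) := by
  have hgen : ∀ᶠ z in residual (ℕ → ℕ × ℕ), ∀ n, ∃ m > n, splice N w z m = (c, n) :=
    eventually_countable_forall.2 fun n =>
      (tendsto_splice_residual N w).eventually (eventually_exists_eq c n)
  filter_upwards [hgen] with z hz
  choose s hs hsz using hz
  refine ⟨fun i => s^[i] 0, rfl, fun i => edgeCode_pair.2 ?_⟩
  have htag : ∀ i, t (splice N w z (s^[i] 0)).1 = θ := fun i => by
    cases i with
    | zero => rw [Function.iterate_zero, id, splice_of_lt hN, hw]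
    | succ i => rw [Function.iterate_succ_apply', hsz, hc]
  refine ⟨?_, ?_, Or.inr ⟨htag _, htag _⟩⟩
  · dsimp only
    rw [Function.iterate_succ_apply']
    exact hs _
  · dsimp only
    rw [Function.iterate_succ_apply', hsz]

end IllFounded

/-! ### Transfer of category from Cantor space -/

section FirstTrue

/-- The sequence whose `n`-th term codes the first place where row `n` of `x` is true. -/
noncomputable def firstTrue (x : Cantor) : ℕ → ℕ × ℕ :=
  fun n => Nat.unpair (sInf {k | x (Nat.pair n k) = true})

lemma firstTrue_congr {x y : Cantor} {n k : ℕ} (hk : x (Nat.pair n k) = true)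
    (h : ∀ j ≤ k, y (Nat.pair n j) = x (Nat.pair n j)) : firstTrue y n = firstTrue x n := by
  have hle : sInf {k | x (Nat.pair n k) = true} ≤ k := Nat.sInf_le hk
  have hx : x (Nat.pair n (sInf {k | x (Nat.pair n k) = true})) = true :=
    Nat.sInf_mem (s := {k | x (Nat.pair n k) = true}) ⟨k, hk⟩
  have hyk : y (Nat.pair n k) = true := (h k le_rfl).trans hk
  have hle' : sInf {k | y (Nat.pair n k) = true} ≤ k := Nat.sInf_le hyk
  have hy : y (Nat.pair n (sInf {k | y (Nat.pair n k) = true})) = true :=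
    Nat.sInf_mem (s := {k | y (Nat.pair n k) = true}) ⟨k, hyk⟩
  unfold firstTrue
  rw [le_antisymm (Nat.sInf_le ((h _ hle).trans hx) : sInf {k | y (Nat.pair n k) = true} ≤ _)
    (Nat.sInf_le ((h _ hle').symm.trans hy))]

lemma continuousAt_firstTrue {x : Cantor} (hx : ∀ n, ∃ k, x (Nat.pair n k) = true) :
    ContinuousAt firstTrue x := by
  refine continuousAt_pi.2 fun n => ?_
  obtain ⟨k, hk⟩ := hx n
  have hev : ∀ᶠ y in 𝓝 x, ∀ j ≤ k, y (Nat.pair n j) = x (Nat.pair n j) :=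
    (finite_Iic k).eventually_all.2 fun j _ =>
      (continuous_apply (Nat.pair n j)).continuousAt.eventually
        ((isOpen_discrete {x (Nat.pair n j)}).mem_nhds rfl)
  exact continuousAt_const.congr (hev.mono fun y hy => (firstTrue_congr hk hy).symm)

lemma dense_interior_preimage_firstTrue {U : Set (ℕ → ℕ × ℕ)} (hU : IsOpen U) (hd : Dense U) :
    Dense (interior (firstTrue ⁻¹' U)) := by
  refine dense_iff_inter_open.2 fun O hO ⟨x, hx⟩ => ?_
  obtain ⟨N, -, hsub⟩ := exists_cylinder_subset hO hx 0
  -- Every row now has a true entry, so `firstTrue` has genuine values on the rows below `N`.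
  let x₁ : Cantor := splice N x fun _ => true
  obtain ⟨z, hz, hzU⟩ := hd.inter_open_nonempty _ (isOpen_cylinder _ (firstTrue x₁) N)
    ⟨_, self_mem_cylinder _ _⟩
  -- The first `N` bits all lie in rows below `N`, so the later rows are free to code `z`.
  let x₂ : Cantor := fun i => if i.unpair.1 < N then x₁ i else
    decide (i.unpair.2 = Nat.pair (z i.unpair.1).1 (z i.unpair.1).2)
  have hlow : ∀ n < N, ∀ k, x₂ (Nat.pair n k) = x₁ (Nat.pair n k) := fun n hn k => by
    simp only [x₂, Nat.unpair_pair, if_pos hn]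
  have hhigh : ∀ n, N ≤ n → ∀ k, x₂ (Nat.pair n k) = true ↔ k = Nat.pair (z n).1 (z n).2 :=
    fun n hn k => by simp only [x₂, Nat.unpair_pair, if_neg hn.not_gt, decide_eq_true_iff]
  have hrow : ∀ n, ∃ k, x₂ (Nat.pair n k) = true := fun n => by
    rcases lt_or_ge n N with hn | hn
    · exact ⟨N, (hlow n hn N).trans (splice_of_le (Nat.right_le_pair n N) _ _)⟩
    · exact ⟨_, (hhigh n hn _).2 rfl⟩
  have hfirst : firstTrue x₂ = z := by
    funext n
    rcases lt_or_ge n N with hn | hn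
    · rw [hz n hn]
      unfold firstTrue
      simp only [hlow n hn]
    · unfold firstTrue
      simp only [hhigh n hn, ofPred_eq_eq_singleton, csInf_singleton, Nat.unpair_pair]
  refine ⟨x₂, hsub fun i hi => ?_, mem_interior_iff_mem_nhds.2
    ((continuousAt_firstTrue hrow).preimage_mem_nhds (hU.mem_nhds (hfirst.symm ▸ hzU)))⟩
  have hi' : i.unpair.1 < N := (Nat.unpair_left_le i).trans_lt hi
  simp only [x₂, if_pos hi']
  exact splice_of_lt hi _ _

lemma tendsto_firstTrue_residual :
    Tendsto firstTrue (residual Cantor) (residual (ℕ → ℕ × ℕ)) := by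
  intro S hS
  obtain ⟨𝒰, hopen, hdense, hcount, hsub⟩ := mem_residual_iff.1 hS
  have : ∀ U ∈ 𝒰, firstTrue ⁻¹' U ∈ residual Cantor := fun U hU =>
    mem_of_superset (residual_of_dense_open isOpen_interior
      (dense_interior_preimage_firstTrue (hopen U hU) (hdense U hU))) interior_subset
  refine mem_of_superset ((countable_bInter_mem hcount).2 this) fun x hx => hsub ?_
  exact mem_sInter.2 fun U hU => mem_iInter₂.1 hx U hU

lemma Forces.exists_firstTrue {X : Set Cantor} (hX : ¬ IsMeagre X) {N : ℕ} {w : ℕ → ℕ × ℕ}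
    {S : Set (ℕ → ℕ × ℕ)} (hS : Forces N w S) : ∃ x ∈ X, splice N w (firstTrue x) ∈ S := by
  by_contra! h
  refine hX (mem_of_superset (tendsto_firstTrue_residual.eventually hS) fun x hx hxX => ?_)
  exact h x hxX hx

end FirstTrue

/-! ### Counting and the final contradiction -/

section Cardinality

lemma not_countable_of_not_isMeagre {X : Set Cantor} (hX : ¬ IsMeagre X) : ¬ X.Countable := by
  intro hc
  refine hX ?_
  rw [← biUnion_of_singleton X]
  refine isMeagre_biUnion hc fun x _ => (isClosed_singleton.isNowhereDense_iff.2 ?_).isMeagre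
  refine eq_empty_of_forall_notMem fun y hy => ?_
  obtain rfl : y = x := mem_singleton_iff.1 (interior_subset hy)
  obtain ⟨M, -, hM⟩ := exists_cylinder_subset isOpen_interior hy 0
  have hmem := interior_subset (hM (update_mem_cylinder y M (!y M)))
  have := congrFun (mem_singleton_iff.1 hmem) M
  simp at this

lemma exists_range_eq_Iic {θ : Ordinal.{0}} (hθ : θ < Ordinal.omega 1) :
    ∃ t : ℕ → Ordinal.{0}, range t = Iic θ := by
  have hc : (Iic θ).Countable := by
    have : (Iio (Order.succ θ)).Countable := by
      rw [← le_aleph0_iff_set_countable, mk_Iio_ordinal, lift_le_aleph0, ← Order.lt_succ_iff,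
        succ_aleph0, ← lt_ord, ord_aleph]
      exact (isSuccLimit_omega 1).succ_lt hθ
    rwa [Order.Iio_succ] at this
  obtain ⟨t, ht⟩ := hc.exists_eq_range ⟨θ, mem_Iic.2 le_rfl⟩
  exact ⟨t, ht.symm⟩

/-- Every nonmeager set gives a set, no larger, on which some analytic set is not relatively
Borel. -/
theorem exists_illFoundedCodes_inter_ne {X : Set Cantor} (hX : ¬ IsMeagre X) :
    ∃ Y : Set Cantor, #Y ≤ #X ∧
      ∀ B : Set Cantor, MeasurableSet B → illFoundedCodes ∩ Y ≠ B ∩ Y := by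
  have hΘ : ∀ a : (Ordinal.omega.{0} 1).ToType,
      Ordinal.typein (α := (Ordinal.omega.{0} 1).ToType) (· < ·) a < Ordinal.omega 1 :=
    fun a => Ordinal.typein_lt_self a
  choose t ht using fun a => exists_range_eq_Iic (hΘ a)
  let g : (Ordinal.omega.{0} 1).ToType × (ℕ × List (ℕ × ℕ)) × X → Cantor := fun a =>
    edgeCode (t a.1) (Ordinal.typein (α := (Ordinal.omega.{0} 1).ToType) (· < ·) a.1)
      (splice a.2.1.1 (fun n => a.2.1.2.getD n default) (firstTrue a.2.2))
  refine ⟨range g, mk_range_le.trans ?_, fun B hB hAB => ?_⟩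
  · have hX1 : ℵ₁ ≤ #X := by
      rw [← succ_aleph0, Order.succ_le_iff, ← not_le, le_aleph0_iff_set_countable]
      exact not_countable_of_not_isMeagre hX
    have hX0 : ℵ₀ ≤ #X := (aleph0_le_aleph 1).trans hX1
    rw [mk_prod, mk_prod, lift_id, lift_id, lift_id, lift_id, mk_toType, Ordinal.card_omega]
    exact mul_le_of_le hX0 hX1 (mul_le_of_le hX0 (mk_le_aleph0.trans hX0) le_rfl)
  · obtain ⟨τ, hτ, hins⟩ := exists_insensitive hB
    -- With `θ = τ + 1` there are two distinct tags, `τ` and `θ`, at or above the threshold.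
    obtain ⟨a, ha⟩ : ∃ a : (Ordinal.omega.{0} 1).ToType,
        Ordinal.typein (α := (Ordinal.omega.{0} 1).ToType) (· < ·) a = Order.succ τ :=
      Ordinal.typein_surj _ (by
        rw [Ordinal.type_toType]; exact (isSuccLimit_omega 1).succ_lt hτ)
    have hta := ht a
    have hmem : ∀ (N : ℕ) (w : ℕ → ℕ × ℕ), ∀ x ∈ X,
        edgeCode (t a) (Order.succ τ) (splice N w (firstTrue x)) ∈ range g := fun N w x hx => by
      refine ⟨(a, (N, (List.range N).map w), ⟨x, hx⟩), ?_⟩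
      simp only [g, ha]
      rw [splice_congr (w := w) fun n hn => ?_]
      simp [hn]
    rw [ha] at hta
    have hiff : ∀ y ∈ range g, y ∈ illFoundedCodes ↔ y ∈ B := fun y hy =>
      ⟨fun h => (hAB.subset ⟨h, hy⟩).1, fun h => (hAB.superset ⟨h, hy⟩).1⟩
    obtain ⟨c, hc⟩ : Order.succ τ ∈ range (t a) := hta.symm ▸ mem_Iic.2 le_rfl
    obtain ⟨d, hd⟩ : τ ∈ range (t a) := hta.symm ▸ mem_Iic.2 (Order.le_succ τ)
    -- Otherwise an extension with root tag `θ` forces both `Bᶜ` and an infinite path, and `X`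
    -- supplies a point of the range of `g` where `B` and `illFoundedCodes` differ.
    have hforce : Forces 1 (fun _ => (c, 0)) (edgeCode (t a) (Order.succ τ) ⁻¹' B) := by
      by_contra hf
      obtain ⟨M, hM, q, hq, hqf⟩ :=
        exists_forces_compl (baireMeasurableSet_preimage_edgeCode hB) hf
      have hq0 : t a (q 0).1 = Order.succ τ := by rw [hq 0 one_pos, hc]
      obtain ⟨x, hx, h1, h2⟩ :=
        (hqf.and (forces_illFoundedCodes hc hM hq0)).exists_firstTrue hX
      exact h1 ((hiff _ (hmem M q x hx)).1 h2)
    -- Lowering the root tag from `θ` to `τ` keeps `B` forced but excludes infinite paths.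
    have hsim : TagSimilar (t a) (Order.succ τ) τ 1 (fun _ => (c, 0)) (fun _ => (d, 0)) :=
      ⟨fun n m hm => iff_of_false (fun h => by have := h.1; omega) fun h => by
        have := h.1; omega, fun n _ => Or.inr ⟨hc ▸ Order.le_succ τ, hd.ge⟩⟩
    obtain ⟨x, hx, hxB⟩ := (hins _ _ hta 1 _ _ hsim hforce).exists_firstTrue hX
    refine edgeCode_notMem_illFoundedCodes ?_ ((hiff _ (hmem 1 _ x hx)).2 hxB)
    rw [splice_of_lt one_pos, hd]
    exact Order.lt_succ τ

lemma exists_mem_snStarCards_le {X : Set Cantor} (hX : ¬ IsMeagre X) :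
    ∃ κ ∈ snStarCards, κ ≤ #X := by
  obtain ⟨Y, hY, h⟩ := exists_illFoundedCodes_inter_ne hX
  refine ⟨#Y, ⟨Y, ⟨illFoundedCodes, analyticSet_illFoundedCodes, fun B hB => h B ?_⟩, rfl⟩, hY⟩
  rwa [BorelSpace.measurable_eq (α := Cantor)]

end Cardinality

/-- The minima defining `sn*` and `non(M)` are taken over nonempty classes of cardinals
(so they are attained), and `sn* ≤ non(M)`. -/
theorem mainTheorem1 :
    snStarCards.Nonempty ∧ nonmeagerCards.Nonempty ∧ snStar ≤ nonM := by
  have huniv : ¬ IsMeagre (univ : Set Cantor) := not_isMeagre_of_mem_residual univ_mem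
  have hne : nonmeagerCards.Nonempty := ⟨_, univ, huniv, rfl⟩
  obtain ⟨κ, hκ, -⟩ := exists_mem_snStarCards_le huniv
  refine ⟨⟨κ, hκ⟩, hne, ?_⟩
  obtain ⟨X, hX, hcard⟩ := csInf_mem hne
  obtain ⟨μ, hμ, hle⟩ := exists_mem_snStarCards_le hX
  exact (csInf_le' hμ).trans (hle.trans hcard.le)
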